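/- Let $S\subset\mathbb{R}$ be a finite set of servers with capacities $c:S\to\{1,2,3,\dots\}$. Requests $r_1,\dots,r_n\in\mathbb{R}$ with $n\le\sum_{s\in S}c(s)$ arrive one by one; an online algorithm must irrevocably match each request $r$, on arrival, with a free server $s$ (one matched so far with fewer than $c(s)$ requests), at cost $|r-s|$. For a request sequence $\sigma$ let $\mathcal A(\sigma)$ be the total cost of the algorithm $\mathcal A$ and $\mathrm{Opt}(\sigma)$ the minimum cost of an offline matching respecting the capacities. $\mathcal A$ is $\rho$-competitive if $\mathcal A(\sigma)\le\rho\,\mathrm{Opt}(\sigma)$ for all such $\sigma$, and its competitive ratio is $\inf\{\rho\ge 1:\mathcal A\text{ is }\rho\text{-competitive}\}$ (with $\inf\emptyset=\infty$). For $T=\{t_1<\dots<t_m\}\subseteq S$ let $L(T)=\dfrac{t_m-t_1}{\max_u(t_{u+1}-t_u)}$ if $m\ge2$ and $L(T)=0$ if $m\le 1$, and let $\alpha(S)=\max_{T\subseteq S}L(T)$. The algorithm PTCP matches a request $r$, when $F\subseteq S$ is the nonempty set of free servers, with the server $\mathcal A^*[S](r,F)$ defined recursively as follows. If $F=\{s\}$,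 then $\mathcal A^*[S](r,F)=s$. Otherwise let $S=\{s_1<\dots<s_k\}$, let $D=s_{a+1}-s_a$ be a largest distance between adjacent servers of $S$ (ties being broken by any fixed rule depending only on the server set), and put $S_1=\{s_1,\dots,s_a\}$, $S_2=\{s_{a+1},\dots,s_k\}$, $\Delta_1=s_a-s_1$, $\Delta_2=s_k-s_{a+1}$ and $x=\dfrac{\Delta_2+D}{(\Delta_1+D)+(\Delta_2+D)}\,D$. Then $\mathcal A^*[S](r,F)=\mathcal A^*[S_1](r,F\cap S_1)$ if ($r\le s_a+x$ and $F\cap S_1\ne\emptyset$) or $F\cap S_2=\emptyset$, and $\mathcal A^*[S](r,F)=\mathcal A^*[S_2](r,F\cap S_2)$ otherwise. A greedy algorithm matches each request with a nearest free server, ties being broken arbitrarily. **Theorem.** Let $k\ge 1$ and $S=\{s_1,\dots,s_k\}$ with $s_1=0$ and $s_i=2^{i-1}$ for $2\le i\le k$. Then $\alpha(S)\le 2$, with $\alpha(S)=2$ if $k\ge 3$. Moreover, for all capacities $c:S\to\{1,2,3,\dots\}$, PTCP is $5$-competitive (whatever the tie-breaking rule), and every greedy algorithm has competitive ratio at least $2^k-1$.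 -/

import Mathlib

noncomputable section

namespace OFAL

/-- A (partial) matching, as a list of pairs `(request, server)`, most recent request first. -/
abbrev Matching := List (ℝ × ℝ)

/-- The total cost of a matching: the sum of the distances between requests and their servers. -/
def cost (M : Matching) : ℝ := (M.map fun e => |e.1 - e.2|).sum

/-- The number of requests that `M` matches with the server `s`. -/
def load (M : Matching) (s : ℝ) : ℕ := (M.map Prod.snd).count s

/-- The servers of `S` that are free after the matching `M`. A server is identified with its
position on the line; only the values of the capacity `c` on `S` matter. -/
def free (S : Finset ℝ) (c : ℝ → ℕ) (M : Matching) : Finset ℝ :=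
  S.filter fun s => load M s < c s

/-- A deterministic online algorithm for the servers `S` with capacities `c`: from the matching
made so far (which records all earlier requests) and the new request it determines the
server for the new request, which is free whenever there is a free server at all. -/
structure OnlineAlgorithm (S : Finset ℝ) (c : ℝ → ℕ) where
  choose : Matching → ℝ → ℝ
  choose_mem : ∀ M r, (free S c M).Nonempty → choose M r ∈ free S c M

/-- The matching that results when `A`, having already built `M`, processes the requests `σ`
in order. -/
def OnlineAlgorithm.runFrom {S : Finset ℝ} {c : ℝ → ℕ} (A : OnlineAlgorithm S c) :
    Matching → List ℝ → Matching
  | M, [] => M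
  | M, r :: σ => A.runFrom ((r, A.choose M r) :: M) σ

/-- The total cost incurred when `A` processes the request sequence `σ`. -/
def OnlineAlgorithm.totalCost {S : Finset ℝ} {c : ℝ → ℕ} (A : OnlineAlgorithm S c)
    (σ : List ℝ) : ℝ := cost (A.runFrom [] σ)

/-- `M` matches the requests of `σ` with servers of `S` and respects the capacities. -/
def IsFeasible (S : Finset ℝ) (c : ℝ → ℕ) (σ : List ℝ) (M : Matching) : Prop :=
  M.map Prod.fst = σ.reverse ∧ (∀ e ∈ M, e.2 ∈ S) ∧ ∀ s ∈ S, load M s ≤ c s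

/-- The optimal offline cost. For `σ.length ≤ ∑ s ∈ S, c s` this is a minimum. -/
def opt (S : Finset ℝ) (c : ℝ → ℕ) (σ : List ℝ) : ℝ :=
  sInf {x | ∃ M, IsFeasible S c σ M ∧ x = cost M}

/-- Strict `ρ`-competitiveness, over all request sequences that the servers can serve. -/
def OnlineAlgorithm.IsCompetitive {S : Finset ℝ} {c : ℝ → ℕ} (A : OnlineAlgorithm S c)
    (ρ : ℝ) : Prop :=
  ∀ σ : List ℝ, σ.length ≤ ∑ s ∈ S, c s → A.totalCost σ ≤ ρ * opt S c σ

/-- The competitive ratio, the infimum of all `ρ ≥ 1` such that `A` is `ρ`-competitive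
(it is `⊤` if there is no such `ρ`). -/
def OnlineAlgorithm.competitiveRatio {S : Finset ℝ} {c : ℝ → ℕ} (A : OnlineAlgorithm S c) :
    EReal :=
  sInf ((fun ρ : ℝ => (ρ : EReal)) '' {ρ : ℝ | 1 ≤ ρ ∧ A.IsCompetitive ρ})

/-- `A` is a greedy algorithm: it matches each request with a nearest free server, ties being
broken arbitrarily. -/
def OnlineAlgorithm.IsGreedy {S : Finset ℝ} {c : ℝ → ℕ} (A : OnlineAlgorithm S c) : Prop :=
  ∀ M r, ∀ s ∈ free S c M, |r - A.choose M r| ≤ |r - s|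

/-- `u < v` are adjacent points of `T`. -/
def IsAdjacent (T : Finset ℝ) (u v : ℝ) : Prop :=
  u ∈ T ∧ v ∈ T ∧ u < v ∧ ∀ t ∈ T, ¬ (u < t ∧ t < v)

/-- `u < v` are adjacent points of `T` at the largest distance of adjacent points. -/
def IsMaxGap (T : Finset ℝ) (u v : ℝ) : Prop :=
  IsAdjacent T u v ∧ ∀ u' v', IsAdjacent T u' v' → v' - u' ≤ v - u

/-- The largest distance between adjacent points of `T`. -/
def maxGap (T : Finset ℝ) : ℝ := sSup {d | ∃ u v, IsAdjacent T u v ∧ d = v - u}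

theorem nonempty_of_two_le {T : Finset ℝ} (h : 2 ≤ T.card) : T.Nonempty :=
  Finset.card_pos.mp (by omega)

/-- The diameter of `T` divided by the largest distance between adjacent points. -/
def L (T : Finset ℝ) : ℝ :=
  if h : 2 ≤ T.card then
    (T.max' (nonempty_of_two_le h) - T.min' (nonempty_of_two_le h)) / maxGap T
  else 0

/-- The maximum of `L T` over all `T ⊆ S`. -/
def alpha (S : Finset ℝ) : ℝ := S.powerset.sup' (Finset.powerset_nonempty S) L

/-- A choice of a largest gap `left T < right T` in each `T` with at least two points. It
only matters when several gaps are largest. -/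
structure SplitRule where
  left : Finset ℝ → ℝ
  right : Finset ℝ → ℝ
  isMaxGap : ∀ T, 2 ≤ T.card → IsMaxGap T (left T) (right T)

/-- The servers of `S` up to the left end of the chosen largest gap. -/
def SplitRule.S₁ (g : SplitRule) (S : Finset ℝ) : Finset ℝ := S.filter (· ≤ g.left S)

/-- The servers of `S` from the right end of the chosen largest gap on. -/
def SplitRule.S₂ (g : SplitRule) (S : Finset ℝ) : Finset ℝ := S.filter (g.right S ≤ ·)

theorem SplitRule.card_S₁_lt (g : SplitRule) {S : Finset ℝ} (h : 2 ≤ S.card) :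
    (g.S₁ S).card < S.card := by
  obtain ⟨⟨-, hv, huv, -⟩, -⟩ := g.isMaxGap S h
  exact Finset.card_lt_card (Finset.filter_ssubset.mpr ⟨_, hv, not_le.mpr huv⟩)

theorem SplitRule.card_S₂_lt (g : SplitRule) {S : Finset ℝ} (h : 2 ≤ S.card) :
    (g.S₂ S).card < S.card := by
  obtain ⟨⟨hu, -, huv, -⟩, -⟩ := g.isMaxGap S h
  exact Finset.card_lt_card (Finset.filter_ssubset.mpr ⟨_, hu, not_le.mpr huv⟩)

/-- The distance `x` from the left end of the chosen largest gap to the critical point. -/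
def SplitRule.offset (g : SplitRule) (S : Finset ℝ) (h : 2 ≤ S.card) : ℝ :=
  let Δ₁ := g.left S - S.min' (nonempty_of_two_le h)
  let Δ₂ := S.max' (nonempty_of_two_le h) - g.right S
  let D := g.right S - g.left S
  (Δ₂ + D) / ((Δ₁ + D) + (Δ₂ + D)) * D

open Classical in
/-- The server with which PTCP for the servers `S` matches the request `r` when `F ⊆ S` is
the nonempty set of free servers (the last branch does not occur for such `F`). -/
def ptcpServer (g : SplitRule) (S : Finset ℝ) (r : ℝ) (F : Finset ℝ) : ℝ :=
  if hF : ∃ s, F = {s} then hF.choose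
  else if h : 2 ≤ S.card then
    if (r ≤ g.left S + g.offset S h ∧ (F ∩ g.S₁ S).Nonempty) ∨ F ∩ g.S₂ S = ∅ then
      ptcpServer g (g.S₁ S) r (F ∩ g.S₁ S)
    else
      ptcpServer g (g.S₂ S) r (F ∩ g.S₂ S)
  else 0
termination_by S.card
decreasing_by
  · exact g.card_S₁_lt h
  · exact g.card_S₂_lt h

theorem ptcpServer_mem (g : SplitRule) (r : ℝ) (S F : Finset ℝ) (hFS : F ⊆ S)
    (hne : F.Nonempty) : ptcpServer g S r F ∈ F := by
  induction hn : S.card using Nat.strong_induction_on generalizing S F with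
  | _ n ih =>
  subst hn
  rw [ptcpServer]
  by_cases hF : ∃ s, F = {s}
  · rw [dif_pos hF]
    have h := hF.choose_spec
    generalize hF.choose = t at h
    simp [h]
  rw [dif_neg hF]
  have h2 : 2 ≤ S.card := by
    have h1 := Finset.card_pos.mpr hne
    have h3 : F.card ≠ 1 := fun h => hF (Finset.card_eq_one.mp h)
    have h4 := Finset.card_le_card hFS
    omega
  rw [dif_pos h2]
  obtain ⟨⟨-, -, -, hadj⟩, -⟩ := g.isMaxGap S h2
  have hcover : ∀ t ∈ F, t ∈ F ∩ g.S₁ S ∨ t ∈ F ∩ g.S₂ S := by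
    intro t ht
    have h5 := hadj t (hFS ht)
    by_cases h6 : t ≤ g.left S
    · exact Or.inl (by simp [SplitRule.S₁, ht, hFS ht, h6])
    · have h7 : g.right S ≤ t := by
        by_contra h8
        exact h5 ⟨not_le.mp h6, not_le.mp h8⟩
      exact Or.inr (by simp [SplitRule.S₂, ht, hFS ht, h7])
  split_ifs with hc
  · have hne1 : (F ∩ g.S₁ S).Nonempty := by
      rcases hc with hc | hc
      · exact hc.2
      · obtain ⟨t, ht⟩ := hne
        rcases hcover t ht with h | h
        · exact ⟨t, h⟩
        · simp [hc] at h
    exact Finset.inter_subset_left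
      (ih _ (g.card_S₁_lt h2) _ _ Finset.inter_subset_right hne1 rfl)
  · have hne2 : (F ∩ g.S₂ S).Nonempty :=
      Finset.nonempty_iff_ne_empty.mpr fun h => hc (Or.inr h)
    exact Finset.inter_subset_left
      (ih _ (g.card_S₂_lt h2) _ _ Finset.inter_subset_right hne2 rfl)

/-- The online algorithm PTCP (Policy Transition at Critical Point), with the largest gaps
chosen by `g`. -/
def ptcp (g : SplitRule) (S : Finset ℝ) (c : ℝ → ℕ) : OnlineAlgorithm S c where
  choose M r := ptcpServer g S r (free S c M)
  choose_mem M r h := ptcpServer_mem g r S (free S c M) (Finset.filter_subset _ _) h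

/-- The position of the `i`-th server: `s₁ = 0` and `sᵢ = 2 ^ (i - 1)` for `i ≥ 2`. -/
def serverPos (i : ℕ) : ℝ := if i = 1 then 0 else 2 ^ (i - 1)

/-- The server layout `s₁, …, s_k`. -/
def layout (k : ℕ) : Finset ℝ := (Finset.Icc 1 k).image serverPos

end OFAL

end

noncomputable section

namespace OFAL

open MeasureTheory

/-! Upper bound. For a matching `E` and a point `y`, count the pairs that cross `y` leftwards,
`leftCross E y`, and rightwards, `rightCross E y`. The cost is the integral of their sum. Their
difference depends only on the requests and on the servers used, so when all capacities are used up
it is the same for PTCP as for any feasible matching, whose cost is thus at least `∫ |leftCross E -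
rightCross E|`. It remains to show that the integral of `excess α E` is at most 0, which says that
the cost of `E` is at most `2 α + 1` times that integral.

This is an induction over the recursive splits of PTCP (`FollowsPtcp.integral_excess_le`). At a
split, requests pass the critical point against the policy in at most one direction
(`FollowsPtcp.overflow`). Beyond the critical point the overflow may raise the excess. Between the
critical point and the near end of the gap, however, the overflow is net flow, which lowers the
excess, and the critical point is placed so that this pays for the raise in either direction
(`SplitRule.left_le_crit`). Shorter sequences are padded with free requests. In the doubling layout
every set has a gap of at least half its diameter, so `α = 2` and the ratio is 5.

Lower bound. Fill every server up to one unit, then request points slightly right of 1, 2, 4, ....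
Greedy sends each to the next server on the right, until the last must travel back to 0; offline
only the first request has to travel far. -/

/-! ### Crossing numbers and cost as an integral -/

open Classical in
/-- The number of pairs of `E` with the property `P`, as a real number. -/
def cnt (P : ℝ × ℝ → Prop) (E : Matching) : ℝ := (E.map fun e => if P e then (1 : ℝ) else 0).sum

theorem cnt_mono {P Q : ℝ × ℝ → Prop} {E : Matching} (h : ∀ e ∈ E, P e → Q e) :
    cnt P E ≤ cnt Q E := by
  classical
  refine List.sum_le_sum fun e he => ?_
  by_cases hP : P e
  · simp [hP, h e he hP]
  · by_cases hQ : Q e <;> simp [hP, hQ]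

theorem cnt_nonneg (P : ℝ × ℝ → Prop) (E : Matching) : 0 ≤ cnt P E := by
  classical
  refine List.sum_nonneg fun x hx => ?_
  obtain ⟨e, -, rfl⟩ := List.mem_map.mp hx
  split_ifs <;> norm_num

theorem cnt_eq_zero {P : ℝ × ℝ → Prop} {E : Matching} (h : ∀ e ∈ E, ¬ P e) : cnt P E = 0 := by
  refine le_antisymm ?_ (cnt_nonneg _ _)
  calc cnt P E ≤ cnt (fun _ => False) E := cnt_mono fun e he hP => h e he hP
    _ = 0 := by simp [cnt]

/-- The number of pairs whose request lies right of `y` and whose server lies left of `y`. -/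
def leftCross (E : Matching) (y : ℝ) : ℝ := cnt (fun e => e.2 < y ∧ y ≤ e.1) E

/-- The number of pairs whose request lies left of `y` and whose server lies right of `y`. -/
def rightCross (E : Matching) (y : ℝ) : ℝ := cnt (fun e => e.1 < y ∧ y ≤ e.2) E

theorem leftCross_cons (e : ℝ × ℝ) (E : Matching) (y : ℝ) :
    leftCross (e :: E) y = (Set.Ioc e.2 e.1).indicator (fun _ => (1 : ℝ)) y + leftCross E y := by
  classical
  simp [leftCross, cnt, Set.indicator_apply]

theorem rightCross_cons (e : ℝ × ℝ) (E : Matching) (y : ℝ) :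
    rightCross (e :: E) y = (Set.Ioc e.1 e.2).indicator (fun _ => (1 : ℝ)) y + rightCross E y := by
  classical
  simp [rightCross, cnt, Set.indicator_apply]

theorem intervalIntegrable_indicator_Ioc (a b p q : ℝ) :
    IntervalIntegrable ((Set.Ioc a b).indicator fun _ => (1 : ℝ)) volume p q :=
  (IntegrableOn.integrable_indicator (by simp) measurableSet_Ioc).intervalIntegrable

theorem intervalIntegrable_leftCross (E : Matching) (p q : ℝ) :
    IntervalIntegrable (leftCross E) volume p q := by
  induction E with
  | nil =>
    have : leftCross [] = fun _ => (0 : ℝ) := by ext; simp [leftCross, cnt]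
    rw [this]; exact intervalIntegrable_const
  | cons e E ih =>
    have : leftCross (e :: E) = (Set.Ioc e.2 e.1).indicator (fun _ => (1 : ℝ)) + leftCross E := by
      ext y; exact leftCross_cons e E y
    rw [this]; exact (intervalIntegrable_indicator_Ioc _ _ _ _).add ih

theorem intervalIntegrable_rightCross (E : Matching) (p q : ℝ) :
    IntervalIntegrable (rightCross E) volume p q := by
  induction E with
  | nil =>
    have : rightCross [] = fun _ => (0 : ℝ) := by ext; simp [rightCross, cnt]
    rw [this]; exact intervalIntegrable_const
  | cons e E ih =>
    have : rightCross (e :: E) = (Set.Ioc e.1 e.2).indicator (fun _ => (1 : ℝ)) + rightCross E := by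
      ext y; exact rightCross_cons e E y
    rw [this]; exact (intervalIntegrable_indicator_Ioc _ _ _ _).add ih

theorem integral_indicator_Ioc_add {a b p q : ℝ} (ha : p ≤ a) (hb : p ≤ b) (ha' : a ≤ q)
    (hb' : b ≤ q) :
    (∫ y in p..q, (Set.Ioc a b).indicator (fun _ => (1 : ℝ)) y) +
      (∫ y in p..q, (Set.Ioc b a).indicator (fun _ => (1 : ℝ)) y) = |b - a| := by
  have key : ∀ a b : ℝ, p ≤ a → b ≤ q →
      (∫ y in p..q, (Set.Ioc a b).indicator (fun _ => (1 : ℝ)) y) = max (b - a) 0 := by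
    intro a b ha hb
    by_cases hpq : p ≤ q
    · rw [intervalIntegral.integral_of_le hpq, setIntegral_indicator measurableSet_Ioc]
      have : Set.Ioc p q ∩ Set.Ioc a b = Set.Ioc a b :=
        Set.inter_eq_right.mpr (Set.Ioc_subset_Ioc ha hb)
      rw [this]
      simp [Measure.real, max_def, ENNReal.toReal_ofReal']
    · exact absurd (ha.trans (by linarith)) hpq
  rw [key a b ha hb', key b a hb ha']
  rcases le_total a b with h | h
  · rw [max_eq_left (by linarith), max_eq_right (by linarith), abs_of_nonneg (by linarith)]; ring
  · rw [max_eq_right (by linarith), max_eq_left (by linarith), abs_of_nonpos (by linarith)]; ring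

/-- A pair crosses exactly the points of the half-open interval between its two ends, so it
contributes its own length. -/
theorem integral_cross {E : Matching} {p q : ℝ}
    (hE : ∀ e ∈ E, p ≤ e.1 ∧ p ≤ e.2 ∧ e.1 ≤ q ∧ e.2 ≤ q) :
    ∫ y in p..q, (leftCross E y + rightCross E y) = cost E := by
  induction E with
  | nil => simp [leftCross, rightCross, cnt, cost]
  | cons e E ih =>
    have ih := ih fun e' he' => hE e' (List.mem_cons_of_mem _ he')
    rw [intervalIntegral.integral_add (intervalIntegrable_leftCross _ _ _)
      (intervalIntegrable_rightCross _ _ _)] at ih ⊢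
    obtain ⟨h1, h2, h3, h4⟩ := hE e List.mem_cons_self
    simp only [leftCross_cons, rightCross_cons]
    rw [intervalIntegral.integral_add (intervalIntegrable_indicator_Ioc _ _ _ _)
      (intervalIntegrable_leftCross _ _ _), intervalIntegral.integral_add
      (intervalIntegrable_indicator_Ioc _ _ _ _) (intervalIntegrable_rightCross _ _ _)]
    have := integral_indicator_Ioc_add h2 h1 h4 h3
    simp only [cost, List.map_cons, List.sum_cons] at ih ⊢
    linarith

/-- The net flow through `y` forgets the matching: only the lists of requests and of servers enter.
This is what makes PTCP comparable with an offline matching. -/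
theorem rightCross_sub_leftCross (E : Matching) (y : ℝ) :
    rightCross E y - leftCross E y =
      ((E.map Prod.fst).map fun r => if r < y then (1 : ℝ) else 0).sum -
        ((E.map Prod.snd).map fun s => if s < y then (1 : ℝ) else 0).sum := by
  induction E with
  | nil => simp [leftCross, rightCross, cnt]
  | cons e E ih =>
    rw [leftCross_cons, rightCross_cons]
    simp only [List.map_cons, List.sum_cons]
    have : (Set.Ioc e.1 e.2).indicator (fun _ => (1 : ℝ)) y -
        (Set.Ioc e.2 e.1).indicator (fun _ => (1 : ℝ)) y =
        (if e.1 < y then (1 : ℝ) else 0) - (if e.2 < y then (1 : ℝ) else 0) := by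
      simp only [Set.indicator_apply, Set.mem_Ioc]
      by_cases h1 : e.1 < y <;> by_cases h2 : e.2 < y <;>
        simp [h1, h2, not_le.mpr, not_lt.mp]
    linarith

/-! ### The excess and its pointwise bounds -/

/-- The excess of the larger one of the two crossing numbers at `y` over `α + 1` times the
absolute value of their difference. -/
def excess (α : ℝ) (E : Matching) (y : ℝ) : ℝ :=
  max (leftCross E y) (rightCross E y) - (α + 1) * |leftCross E y - rightCross E y|

theorem intervalIntegrable_abs_cross (E : Matching) (p q : ℝ) :
    IntervalIntegrable (fun y => |leftCross E y - rightCross E y|) volume p q :=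
  ((intervalIntegrable_leftCross E p q).sub (intervalIntegrable_rightCross E p q)).abs

theorem max_eq_half (a b : ℝ) : max a b = (a + b + |a - b|) / 2 := by
  rcases le_total a b with h | h
  · rw [max_eq_right h, abs_of_nonpos (by linarith)]; ring
  · rw [max_eq_left h, abs_of_nonneg (by linarith)]; ring

/-- In this form the integral of the excess is half the cost minus `α + 1/2` times the integrated
absolute net flow, whence the factor `2 α + 1`. -/
theorem excess_eq (α : ℝ) (E : Matching) (y : ℝ) :
    excess α E y = 2⁻¹ * (leftCross E y + rightCross E y) -
      (α + 2⁻¹) * |leftCross E y - rightCross E y| := by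
  rw [excess, max_eq_half]; ring

theorem intervalIntegrable_excess (α : ℝ) (E : Matching) (p q : ℝ) :
    IntervalIntegrable (excess α E) volume p q := by
  have : excess α E = fun y => 2⁻¹ * (leftCross E y + rightCross E y) -
      (α + 2⁻¹) * |leftCross E y - rightCross E y| := funext (excess_eq α E)
  rw [this]
  exact (((intervalIntegrable_leftCross E p q).add
    (intervalIntegrable_rightCross E p q)).const_mul _).sub
    ((intervalIntegrable_abs_cross E p q).const_mul _)

theorem integral_excess_le {α : ℝ} {E : Matching} {p q C : ℝ} (hpq : p ≤ q)
    (h : ∀ y ∈ Set.Ioo p q, excess α E y ≤ C) : ∫ y in p..q, excess α E y ≤ C * (q - p) := by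
  calc ∫ y in p..q, excess α E y ≤ ∫ _ in p..q, C :=
        intervalIntegral.integral_mono_on_of_le_Ioo hpq (intervalIntegrable_excess α E p q)
          intervalIntegrable_const h
    _ = C * (q - p) := by simp [mul_comm]

/-- Since `α ≥ 0`, the excess is at most the smaller crossing number, so a bound on either direction
suffices. -/
theorem excess_le_left {α : ℝ} (hα : 0 ≤ α) {E : Matching} {y C : ℝ} (h : leftCross E y ≤ C) :
    excess α E y ≤ C := by
  have h1 := abs_nonneg (leftCross E y - rightCross E y)
  have h2 := le_abs_self (leftCross E y - rightCross E y)
  have h3 := neg_abs_le (leftCross E y - rightCross E y)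
  rw [excess_eq]
  nlinarith [mul_nonneg hα h1]

theorem excess_le_right {α : ℝ} (hα : 0 ≤ α) {E : Matching} {y C : ℝ} (h : rightCross E y ≤ C) :
    excess α E y ≤ C := by
  have h1 := abs_nonneg (leftCross E y - rightCross E y)
  have h2 := le_abs_self (leftCross E y - rightCross E y)
  have h3 := neg_abs_le (leftCross E y - rightCross E y)
  rw [excess_eq]
  nlinarith [mul_nonneg hα h1]

/-- Leftward crossings beyond `Λ` cannot be balanced by the at most `Λ` rightward ones. They are net
flow, and each of them costs the excess a further `α`. -/
theorem excess_le_of_left_ge {α : ℝ} (hα : 0 ≤ α) {E : Matching} {y Λ N : ℝ}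
    (hr : rightCross E y ≤ Λ) (hl : N ≤ leftCross E y) :
    excess α E y ≤ Λ - α * (max Λ N - Λ) := by
  rcases le_total N Λ with h | h
  · rw [max_eq_left h]; simpa using excess_le_right hα hr
  · have h2 := le_abs_self (leftCross E y - rightCross E y)
    rw [max_eq_right h, excess, max_eq_left (by linarith), abs_of_nonneg (by linarith)]
    nlinarith

theorem excess_le_of_right_ge {α : ℝ} (hα : 0 ≤ α) {E : Matching} {y Λ N : ℝ}
    (hl : leftCross E y ≤ Λ) (hr : N ≤ rightCross E y) :
    excess α E y ≤ Λ - α * (max Λ N - Λ) := by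
  rcases le_total N Λ with h | h
  · rw [max_eq_left h]; simpa using excess_le_left hα hl
  · rw [max_eq_right h, excess, max_eq_right (by linarith), abs_of_nonpos (by linarith)]
    nlinarith

/-! ### One split of PTCP -/

/-- The critical point of the chosen largest gap. -/
def SplitRule.crit (g : SplitRule) (T : Finset ℝ) (h : 2 ≤ T.card) : ℝ := g.left T + g.offset T h

theorem SplitRule.disjoint_S₁_S₂ (g : SplitRule) {T : Finset ℝ} (h : 2 ≤ T.card) :
    Disjoint (g.S₁ T) (g.S₂ T) := by
  obtain ⟨⟨-, -, huv, -⟩, -⟩ := g.isMaxGap T h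
  refine Finset.disjoint_left.mpr fun s h1 h2 => ?_
  simp only [SplitRule.S₁, SplitRule.S₂, Finset.mem_filter] at h1 h2
  linarith [h1.2, h2.2]

theorem ptcpServer_singleton (g : SplitRule) (T : Finset ℝ) (r s : ℝ) :
    ptcpServer g T r {s} = s := by
  rw [ptcpServer, dif_pos ⟨s, rfl⟩]
  have hF : ∃ t, ({s} : Finset ℝ) = {t} := ⟨s, rfl⟩
  exact (Finset.singleton_inj.mp hF.choose_spec).symm

/-- With a single free server the recursion stops without consulting the critical point; but then
the other half has no free server, so the alternative holds all the same. -/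
theorem ptcpServer_of_mem_S₁ (g : SplitRule) {T F : Finset ℝ} {r : ℝ} (h : 2 ≤ T.card)
    (hF : F ⊆ T) (hne : F.Nonempty) (ha : ptcpServer g T r F ∈ g.S₁ T) :
    ptcpServer g T r F = ptcpServer g (g.S₁ T) r (F ∩ g.S₁ T) ∧
      (r ≤ g.crit T h ∨ F ∩ g.S₂ T = ∅) := by
  have hd := Finset.disjoint_left.mp (g.disjoint_S₁_S₂ h)
  by_cases hs : ∃ s, F = {s}
  · obtain ⟨s, rfl⟩ := hs
    rw [ptcpServer_singleton] at ha ⊢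
    rw [Finset.singleton_inter_of_mem ha, ptcpServer_singleton,
      Finset.singleton_inter_of_notMem (hd ha)]
    simp
  · have hm := ptcpServer_mem g r T F hF hne
    rw [ptcpServer, dif_neg hs, dif_pos h] at ha hm ⊢
    split_ifs at ha hm ⊢ with hc
    · exact ⟨rfl, hc.imp And.left id⟩
    · refine absurd ?_ (hd ha)
      have hne2 : (F ∩ g.S₂ T).Nonempty :=
        Finset.nonempty_iff_ne_empty.mpr fun h => hc (Or.inr h)
      exact (Finset.mem_inter.mp (ptcpServer_mem g r _ _ Finset.inter_subset_right hne2)).2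

theorem ptcpServer_of_mem_S₂ (g : SplitRule) {T F : Finset ℝ} {r : ℝ} (h : 2 ≤ T.card)
    (hF : F ⊆ T) (hne : F.Nonempty) (ha : ptcpServer g T r F ∈ g.S₂ T) :
    ptcpServer g T r F = ptcpServer g (g.S₂ T) r (F ∩ g.S₂ T) ∧
      (g.crit T h ≤ r ∨ F ∩ g.S₁ T = ∅) := by
  have hd := Finset.disjoint_right.mp (g.disjoint_S₁_S₂ h)
  by_cases hs : ∃ s, F = {s}
  · obtain ⟨s, rfl⟩ := hs
    rw [ptcpServer_singleton] at ha ⊢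
    rw [Finset.singleton_inter_of_mem ha, ptcpServer_singleton,
      Finset.singleton_inter_of_notMem (hd ha)]
    simp
  · have hm := ptcpServer_mem g r T F hF hne
    rw [ptcpServer, dif_neg hs, dif_pos h] at ha hm ⊢
    split_ifs at ha hm ⊢ with hc
    · by_cases hne1 : (F ∩ g.S₁ T).Nonempty
      · exact absurd (Finset.mem_inter.mp
          (ptcpServer_mem g r _ _ Finset.inter_subset_right hne1)).2 (hd ha)
      · have h2 : F ∩ g.S₂ T = ∅ := hc.resolve_left fun h => hne1 h.2
        exact absurd (h2 ▸ Finset.mem_inter.mpr ⟨hm, ha⟩) (Finset.notMem_empty _)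
    · refine ⟨rfl, ?_⟩
      by_contra! hcon
      exact hc (Or.inl ⟨hcon.1.le, hcon.2⟩)

/-- Every pair of `E` was added to the earlier pairs by PTCP, as far as servers in `T` are
concerned. -/
def FollowsPtcp (g : SplitRule) (S : Finset ℝ) (c : ℝ → ℕ) (T : Finset ℝ) (E : Matching) : Prop :=
  ∀ r a M, (r, a) :: M <:+ E → a ∈ free S c M ∧
    (a ∈ T → a = ptcpServer g T r (free S c M ∩ T))

theorem free_anti {S : Finset ℝ} {c : ℝ → ℕ} {M M' : Matching} (h : M <:+ M') :
    free S c M' ⊆ free S c M := by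
  intro s hs
  simp only [free, Finset.mem_filter] at hs ⊢
  refine ⟨hs.1, lt_of_le_of_lt ?_ hs.2⟩
  exact (h.sublist.map Prod.snd).count_le s

theorem SplitRule.S₁_subset (g : SplitRule) (T : Finset ℝ) : g.S₁ T ⊆ T := Finset.filter_subset _ _

theorem SplitRule.S₂_subset (g : SplitRule) (T : Finset ℝ) : g.S₂ T ⊆ T := Finset.filter_subset _ _

theorem inter_inter_of_subset {F T U : Finset ℝ} (h : U ⊆ T) : F ∩ T ∩ U = F ∩ U := by
  rw [Finset.inter_assoc, Finset.inter_eq_right.mpr h]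

theorem FollowsPtcp.S₁ {g : SplitRule} {S : Finset ℝ} {c : ℝ → ℕ} {T : Finset ℝ} {E : Matching}
    (hE : FollowsPtcp g S c T E) (h : 2 ≤ T.card) {r a : ℝ} {M : Matching}
    (hs : (r, a) :: M <:+ E) (ha : a ∈ g.S₁ T) :
    a = ptcpServer g (g.S₁ T) r (free S c M ∩ g.S₁ T) ∧
      (r ≤ g.crit T h ∨ free S c M ∩ g.S₂ T = ∅) := by
  obtain ⟨h1, h2⟩ := hE r a M hs
  have haT := g.S₁_subset T ha
  have h2 := h2 haT
  have := ptcpServer_of_mem_S₁ g (r := r) h (F := free S c M ∩ T) Finset.inter_subset_right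
    ⟨a, Finset.mem_inter.mpr ⟨h1, haT⟩⟩ (h2 ▸ ha)
  rwa [← h2, inter_inter_of_subset (g.S₁_subset T), inter_inter_of_subset (g.S₂_subset T)] at this

theorem FollowsPtcp.S₂ {g : SplitRule} {S : Finset ℝ} {c : ℝ → ℕ} {T : Finset ℝ} {E : Matching}
    (hE : FollowsPtcp g S c T E) (h : 2 ≤ T.card) {r a : ℝ} {M : Matching}
    (hs : (r, a) :: M <:+ E) (ha : a ∈ g.S₂ T) :
    a = ptcpServer g (g.S₂ T) r (free S c M ∩ g.S₂ T) ∧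
      (g.crit T h ≤ r ∨ free S c M ∩ g.S₁ T = ∅) := by
  obtain ⟨h1, h2⟩ := hE r a M hs
  have haT := g.S₂_subset T ha
  have h2 := h2 haT
  have := ptcpServer_of_mem_S₂ g (r := r) h (F := free S c M ∩ T) Finset.inter_subset_right
    ⟨a, Finset.mem_inter.mpr ⟨h1, haT⟩⟩ (h2 ▸ ha)
  rwa [← h2, inter_inter_of_subset (g.S₁_subset T), inter_inter_of_subset (g.S₂_subset T)] at this

theorem exists_suffix_of_mem {E : Matching} {e : ℝ × ℝ} (he : e ∈ E) : ∃ M, e :: M <:+ E := by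
  obtain ⟨l, M, rfl⟩ := List.append_of_mem he
  exact ⟨M, List.suffix_append _ _⟩

/-- Requests overflow the critical point of a node in at most one direction. -/
theorem FollowsPtcp.overflow {g : SplitRule} {S : Finset ℝ} {c : ℝ → ℕ} {T : Finset ℝ}
    {E : Matching} (hE : FollowsPtcp g S c T E) (h : 2 ≤ T.card) :
    (∀ e ∈ E, e.2 ∈ g.S₂ T → g.crit T h ≤ e.1) ∨ (∀ e ∈ E, e.2 ∈ g.S₁ T → e.1 ≤ g.crit T h) := by
  by_contra! hcon
  obtain ⟨⟨⟨r, a⟩, he, ha, hr⟩, ⟨⟨r', a'⟩, he', ha', hr'⟩⟩ := hcon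
  obtain ⟨M, hM⟩ := exists_suffix_of_mem he
  obtain ⟨M', hM'⟩ := exists_suffix_of_mem he'
  have hf := (hE.S₂ h hM ha).2.resolve_left (not_le.mpr hr)
  have hf' := (hE.S₁ h hM' ha').2.resolve_left (not_le.mpr hr')
  have h1 := (hE r a M hM).1
  have h1' := (hE r' a' M' hM').1
  -- Each of the two pairs certifies that the half it avoids is full. Full halves stay full, so the
  -- later pair could not have used its server.
  rcases List.suffix_or_suffix_of_suffix ((List.suffix_cons _ _).trans hM)
    ((List.suffix_cons _ _).trans hM') with hs | hs
  · exact absurd (hf ▸ Finset.mem_inter.mpr ⟨free_anti hs h1', ha'⟩) (Finset.notMem_empty _)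
  · exact absurd (hf' ▸ Finset.mem_inter.mpr ⟨free_anti hs h1, ha⟩) (Finset.notMem_empty _)

/-- The critical point divides the gap in the ratio of `q - left` to `right - p`. Hence both
quotients bounded here equal `(q - p) / (right - left) + 1`, and one choice serves overflow in
either direction. -/
theorem SplitRule.left_le_crit (g : SplitRule) {T : Finset ℝ} (h : 2 ≤ T.card) {p q α : ℝ}
    (hp : IsLeast (T : Set ℝ) p) (hq : IsGreatest (T : Set ℝ) q)
    (hα : q - p ≤ α * (g.right T - g.left T)) :
    g.left T ≤ g.crit T h ∧ g.crit T h ≤ g.right T ∧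
      q - g.left T ≤ (α + 1) * (g.crit T h - g.left T) ∧
      g.right T - p ≤ (α + 1) * (g.right T - g.crit T h) := by
  obtain ⟨⟨hu, hv, huv, -⟩, -⟩ := g.isMaxGap T h
  have hp' : T.min' (nonempty_of_two_le h) = p := (T.isLeast_min' _).unique hp
  have hq' : T.max' (nonempty_of_two_le h) = q := (T.isGreatest_max' _).unique hq
  have hpu := hp.2 hu
  have hvq := hq.2 hv
  simp only [SplitRule.crit, SplitRule.offset, hp', hq']
  generalize g.left T = u at *
  generalize g.right T = v at *
  have hden : 0 < (u - p + (v - u)) + (q - v + (v - u)) := by linarith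
  have hx : (q - v + (v - u)) / ((u - p + (v - u)) + (q - v + (v - u))) * (v - u) *
      ((u - p + (v - u)) + (q - v + (v - u))) = (q - v + (v - u)) * (v - u) := by
    field_simp
  generalize (q - v + (v - u)) / ((u - p + (v - u)) + (q - v + (v - u))) * (v - u) = x at hx
  have hx' : x * (v - p + (q - u)) = (q - u) * (v - u) := by linear_combination hx
  have h0 : 0 < v - p + (q - u) := by linarith
  have hle : v - p + (q - u) ≤ (α + 1) * (v - u) := by linarith
  have hα1 : 0 ≤ α + 1 := by
    by_contra hneg
    nlinarith
  refine ⟨?_, ?_, ?_, ?_⟩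
  · have : 0 ≤ x := by
      by_contra hneg
      nlinarith
    linarith
  · have : x ≤ v - u := by
      by_contra hneg
      nlinarith
    linarith
  · refine le_of_mul_le_mul_right ?_ h0
    nlinarith
  · refine le_of_mul_le_mul_right ?_ h0
    nlinarith

/-! ### The induction over the splits -/

/-- `Λ` bounds the pairs that leave the hull of `T` for servers beyond either end. Such pairs are
beyond the control of the node, and carrying them along lets a half inherit the overflow of its
sibling. -/
theorem FollowsPtcp.integral_excess_le {g : SplitRule} {S : Finset ℝ} {c : ℝ → ℕ} {α : ℝ}
    (hα0 : 0 ≤ α)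
    (hα : ∀ T ⊆ S, 2 ≤ T.card → ∀ p ∈ T, ∀ q ∈ T, q - p ≤ α * (g.right T - g.left T))
    {E : Matching} (T : Finset ℝ) (hTS : T ⊆ S) (hE : FollowsPtcp g S c T E) {p q : ℝ}
    (hp : IsLeast (T : Set ℝ) p) (hq : IsGreatest (T : Set ℝ) q)
    (hT : ∀ s ∈ S, p ≤ s → s ≤ q → s ∈ T) {Λ : ℝ}
    (hr : cnt (fun e => e.1 < q ∧ q < e.2) E ≤ Λ) (hl : cnt (fun e => p < e.1 ∧ e.2 < p) E ≤ Λ) :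
    ∫ y in p..q, excess α E y ≤ Λ * (q - p) := by
  induction hn : T.card using Nat.strong_induction_on generalizing T p q Λ with
  | _ n ih =>
  subst hn
  have hpq : p ≤ q := hp.2 hq.1
  by_cases h : 2 ≤ T.card
  swap
  · have : p = q := Finset.card_le_one.mp (by omega) p hp.1 q hq.1
    subst this
    simp
  have hmem : ∀ e ∈ E, e.2 ∈ S := by
    rintro ⟨r, a⟩ he
    obtain ⟨M, hM⟩ := exists_suffix_of_mem he
    exact (Finset.mem_filter.mp (hE r a M hM).1).1
  obtain ⟨hκ1, hκ2, hx1, hx2⟩ := g.left_le_crit h hp hq (hα T hTS h p hp.1 q hq.1)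
  obtain ⟨⟨hu, hv, huv, hadj⟩, -⟩ := g.isMaxGap T h
  have hov := hE.overflow h
  have hpu : p ≤ g.left T := hp.2 hu
  have hvq : g.right T ≤ q := hq.2 hv
  have hE1 : FollowsPtcp g S c (g.S₁ T) E := fun r a M hM =>
    ⟨(hE r a M hM).1, fun ha => (hE.S₁ h hM ha).1⟩
  have hE2 : FollowsPtcp g S c (g.S₂ T) E := fun r a M hM =>
    ⟨(hE r a M hM).1, fun ha => (hE.S₂ h hM ha).1⟩
  have hm1 : ∀ s, s ∈ g.S₁ T ↔ s ∈ T ∧ s ≤ g.left T := fun s => Finset.mem_filter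
  have hm2 : ∀ s, s ∈ g.S₂ T ↔ s ∈ T ∧ g.right T ≤ s := fun s => Finset.mem_filter
  have ih1 : ∀ Λ', cnt (fun e => e.1 < g.left T ∧ g.left T < e.2) E ≤ Λ' →
      cnt (fun e => p < e.1 ∧ e.2 < p) E ≤ Λ' →
      ∫ y in p..g.left T, excess α E y ≤ Λ' * (g.left T - p) := fun Λ' h1 h2 =>
    ih _ (g.card_S₁_lt h) _ ((g.S₁_subset T).trans hTS) hE1
      ⟨(hm1 p).mpr ⟨hp.1, hpu⟩, fun s hs => hp.2 ((hm1 s).mp hs).1⟩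
      ⟨(hm1 _).mpr ⟨hu, le_rfl⟩, fun s hs => ((hm1 s).mp hs).2⟩
      (fun s hs h1 h2 => (hm1 s).mpr ⟨hT s hs h1 (by linarith), h2⟩) h1 h2 rfl
  have ih2 : ∀ Λ', cnt (fun e => e.1 < q ∧ q < e.2) E ≤ Λ' →
      cnt (fun e => g.right T < e.1 ∧ e.2 < g.right T) E ≤ Λ' →
      ∫ y in g.right T..q, excess α E y ≤ Λ' * (q - g.right T) := fun Λ' h1 h2 =>
    ih _ (g.card_S₂_lt h) _ ((g.S₂_subset T).trans hTS) hE2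
      ⟨(hm2 _).mpr ⟨hv, le_rfl⟩, fun s hs => ((hm2 s).mp hs).2⟩
      ⟨(hm2 q).mpr ⟨hq.1, hvq⟩, fun s hs => hq.2 ((hm2 s).mp hs).1⟩
      (fun s hs h1 h2 => (hm2 s).mpr ⟨hT s hs (by linarith) h2, h1⟩) h1 h2 rfl
  clear ih hE1 hE2 hE
  have hgap : ∀ e ∈ E, e.2 ≤ g.left T ∨ g.right T ≤ e.2 := by
    intro e he
    by_contra! hcon
    exact hadj _ (hT _ (hmem e he) (by linarith) (by linarith)) hcon
  have hin1 : ∀ e ∈ E, e.2 ≤ g.left T → p ≤ e.2 → e.2 ∈ g.S₁ T := fun e he h1 h2 =>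
    (hm1 _).mpr ⟨hT _ (hmem e he) h2 (by linarith), h1⟩
  have hin2 : ∀ e ∈ E, g.right T ≤ e.2 → e.2 ≤ q → e.2 ∈ g.S₂ T := fun e he h1 h2 =>
    (hm2 _).mpr ⟨hT _ (hmem e he) (by linarith) h2, h1⟩
  generalize g.crit T h = κ at *
  generalize g.left T = u at *
  generalize g.right T = v at *
  have hsplit : ∫ y in p..q, excess α E y = (∫ y in p..u, excess α E y) +
      (∫ y in u..κ, excess α E y) + (∫ y in κ..v, excess α E y) + ∫ y in v..q, excess α E y := by
    have hi := intervalIntegrable_excess α E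
    rw [intervalIntegral.integral_add_adjacent_intervals (hi _ _) (hi _ _),
      intervalIntegral.integral_add_adjacent_intervals (hi _ _) (hi _ _),
      intervalIntegral.integral_add_adjacent_intervals (hi _ _) (hi _ _)]
  rw [hsplit]
  rcases hov with hov | hov
  -- No request left of `κ` uses a server of the right half, and `N` counts the pairs that overflow
  -- to the left. The left half keeps the bound `Λ`; the right half, and the gap right of `κ`, get
  -- `max Λ N`; on `(u, κ)` all `N` pairs cross leftwards and at most `Λ` rightwards.
  · set N := cnt (fun e => κ < e.1 ∧ e.2 ≤ u) E
    have hΛ : Λ ≤ max Λ N := le_max_left _ _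
    have i1 := ih1 Λ ((cnt_mono fun e he hP => by
      rcases hgap e he with h1 | h1
      · exact absurd hP.2 (not_lt.mpr h1)
      · by_cases h2 : e.2 ≤ q
        · linarith [hov e he (hin2 e he h1 h2), hP.1]
        · exact ⟨by linarith [hP.1], not_le.mp h2⟩).trans hr) hl
    have i2 := ih2 (max Λ N) (hr.trans hΛ) ((cnt_mono fun e he hP => by
      rcases hgap e he with h1 | h1
      · exact ⟨by linarith [hP.1], h1⟩
      · linarith [hP.2]).trans (le_max_right Λ N))
    have i3 := OFAL.integral_excess_le (α := α) (E := E) hκ1 fun y hy =>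
      excess_le_of_left_ge (N := N) hα0 ((cnt_mono fun e he hP => by
        rcases hgap e he with h1 | h1
        · linarith [hy.1, hP.2]
        · by_cases h2 : e.2 ≤ q
          · linarith [hov e he (hin2 e he h1 h2), hP.1, hy.2]
          · exact ⟨by linarith [hP.1, hy.2], not_le.mp h2⟩).trans hr)
        (cnt_mono fun e he hP => ⟨by linarith [hP.2, hy.1], by linarith [hP.1, hy.2]⟩)
    have i4 := OFAL.integral_excess_le (α := α) (E := E) hκ2 fun y hy =>
      excess_le_left hα0 ((cnt_mono fun e he hP => by
        rcases hgap e he with h1 | h1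
        · exact ⟨by linarith [hP.2, hy.1], h1⟩
        · linarith [hP.1, hy.2]).trans (le_max_right Λ N))
    -- With `δ = max Λ N - Λ` the four bounds add up to `Λ * (q - p) + δ * ((q - κ) - α * (κ - u))`,
    -- and `hx1` makes the last factor nonpositive.
    nlinarith
  -- The mirror image, with `hx2` in place of `hx1`.
  · set N := cnt (fun e => e.1 < κ ∧ v ≤ e.2) E
    have hΛ : Λ ≤ max Λ N := le_max_left _ _
    have i2 := ih2 Λ hr ((cnt_mono fun e he hP => by
      rcases hgap e he with h1 | h1
      · by_cases h2 : p ≤ e.2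
        · linarith [hov e he (hin1 e he h1 h2), hP.1]
        · exact ⟨by linarith [hP.1], not_le.mp h2⟩
      · exact absurd hP.2 (not_lt.mpr h1)).trans hl)
    have i1 := ih1 (max Λ N) ((cnt_mono fun e he hP => by
      rcases hgap e he with h1 | h1
      · linarith [hP.2]
      · exact ⟨by linarith [hP.1], h1⟩).trans (le_max_right Λ N)) (hl.trans hΛ)
    have i3 := OFAL.integral_excess_le (α := α) (E := E) hκ2 fun y hy =>
      excess_le_of_right_ge (N := N) hα0 ((cnt_mono fun e he hP => by
        rcases hgap e he with h1 | h1
        · by_cases h2 : p ≤ e.2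
          · linarith [hov e he (hin1 e he h1 h2), hP.2, hy.1]
          · exact ⟨by linarith [hP.2, hy.1], not_le.mp h2⟩
        · linarith [hy.2, hP.1]).trans hl)
        (cnt_mono fun e he hP => ⟨by linarith [hP.1, hy.1], by linarith [hP.2, hy.2]⟩)
    have i4 := OFAL.integral_excess_le (α := α) (E := E) hκ1 fun y hy =>
      excess_le_right hα0 ((cnt_mono fun e he hP => by
        rcases hgap e he with h1 | h1
        · linarith [hP.2, hy.1]
        · exact ⟨by linarith [hP.1, hy.2], h1⟩).trans (le_max_right Λ N))
    nlinarith

/-! ### Runs of online algorithms and feasible matchings -/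

theorem sum_count_eq_length {S : Finset ℝ} {l : List ℝ} (h : ∀ s ∈ l, s ∈ S) :
    ∑ s ∈ S, l.count s = l.length := by
  simpa using Multiset.sum_count_eq_card (s := S) (m := (l : Multiset ℝ)) (by simpa using h)

theorem load_cons (r a s : ℝ) (M : Matching) :
    load ((r, a) :: M) s = load M s + if a = s then 1 else 0 := by
  simp [load, List.count_cons]

theorem sum_load {S : Finset ℝ} {M : Matching} (h : ∀ e ∈ M, e.2 ∈ S) :
    ∑ s ∈ S, load M s = M.length := by
  have := sum_count_eq_length (S := S) (l := M.map Prod.snd) (by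
    intro s hs
    obtain ⟨e, he, rfl⟩ := List.mem_map.mp hs
    exact h e he)
  simpa [load] using this

theorem free_nonempty {S : Finset ℝ} {c : ℝ → ℕ} {M : Matching} (h : ∀ e ∈ M, e.2 ∈ S)
    (hlt : M.length < ∑ s ∈ S, c s) : (free S c M).Nonempty := by
  rw [← sum_load h] at hlt
  obtain ⟨s, hs, hs'⟩ := Finset.exists_lt_of_sum_lt hlt
  exact ⟨s, Finset.mem_filter.mpr ⟨hs, hs'⟩⟩

theorem runFrom_append {S : Finset ℝ} {c : ℝ → ℕ} (A : OnlineAlgorithm S c) (M : Matching)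
    (σ τ : List ℝ) : A.runFrom M (σ ++ τ) = A.runFrom (A.runFrom M σ) τ := by
  induction σ generalizing M with
  | nil => rfl
  | cons r σ ih => exact ih _

theorem cost_cons (e : ℝ × ℝ) (M : Matching) : cost (e :: M) = |e.1 - e.2| + cost M := by
  simp [cost]

theorem cost_le_cost_runFrom {S : Finset ℝ} {c : ℝ → ℕ} (A : OnlineAlgorithm S c) (M : Matching)
    (σ : List ℝ) : cost M ≤ cost (A.runFrom M σ) := by
  induction σ generalizing M with
  | nil => exact le_rfl
  | cons r σ ih =>
    refine le_trans ?_ (ih _)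
    rw [cost_cons]
    linarith [abs_nonneg (r - A.choose M r)]

/-- Every pair of `E` was added to the earlier pairs by the algorithm `A`, at a free server. -/
def Follows {S : Finset ℝ} {c : ℝ → ℕ} (A : OnlineAlgorithm S c) (E : Matching) : Prop :=
  ∀ r a M, (r, a) :: M <:+ E → a ∈ free S c M ∧ a = A.choose M r

theorem Follows.cons {S : Finset ℝ} {c : ℝ → ℕ} {A : OnlineAlgorithm S c} {E : Matching} {r : ℝ}
    (hE : Follows A E) (h : (free S c E).Nonempty) : Follows A ((r, A.choose E r) :: E) := by
  intro r' a M hM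
  rcases List.suffix_cons_iff.mp hM with heq | hM
  · simp only [List.cons.injEq, Prod.mk.injEq] at heq
    obtain ⟨⟨rfl, rfl⟩, rfl⟩ := heq
    exact ⟨A.choose_mem _ _ h, rfl⟩
  · exact hE r' a M hM

theorem Follows.mem {S : Finset ℝ} {c : ℝ → ℕ} {A : OnlineAlgorithm S c} {E : Matching}
    (hE : Follows A E) : ∀ e ∈ E, e.2 ∈ S := by
  rintro ⟨r, a⟩ he
  obtain ⟨M, hM⟩ := exists_suffix_of_mem he
  exact (Finset.mem_filter.mp (hE r a M hM).1).1

theorem Follows.load_le {S : Finset ℝ} {c : ℝ → ℕ} {A : OnlineAlgorithm S c} {E : Matching}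
    (hE : Follows A E) {s : ℝ} : load E s ≤ c s := by
  induction E with
  | nil => simp [load]
  | cons e E ih =>
    obtain ⟨r, a⟩ := e
    have h1 := ih fun r a M hM => hE r a M (hM.trans (List.suffix_cons _ _))
    have h2 := (Finset.mem_filter.mp (hE r a E List.suffix_rfl).1).2
    rw [load_cons]
    split_ifs with h
    · subst h; omega
    · exact h1

theorem follows_runFrom {S : Finset ℝ} {c : ℝ → ℕ} {A : OnlineAlgorithm S c} {M : Matching}
    (hM : Follows A M) {σ : List ℝ} (h : M.length + σ.length ≤ ∑ s ∈ S, c s) :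
    Follows A (A.runFrom M σ) := by
  induction σ generalizing M with
  | nil => exact hM
  | cons r σ ih =>
    simp only [List.length_cons] at h
    refine ih (hM.cons (free_nonempty hM.mem (by omega))) ?_
    simp only [List.length_cons]
    omega

theorem map_fst_runFrom {S : Finset ℝ} {c : ℝ → ℕ} (A : OnlineAlgorithm S c) (M : Matching)
    (σ : List ℝ) : (A.runFrom M σ).map Prod.fst = σ.reverse ++ M.map Prod.fst := by
  induction σ generalizing M with
  | nil => rfl
  | cons r σ ih => rw [OnlineAlgorithm.runFrom, ih]; simp

theorem follows_nil {S : Finset ℝ} {c : ℝ → ℕ} (A : OnlineAlgorithm S c) : Follows A [] := by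
  intro r a M h
  simp at h

theorem isFeasible_runFrom {S : Finset ℝ} {c : ℝ → ℕ} (A : OnlineAlgorithm S c) {σ : List ℝ}
    (h : σ.length ≤ ∑ s ∈ S, c s) : IsFeasible S c σ (A.runFrom [] σ) := by
  have hf := follows_runFrom (follows_nil A) (σ := σ) (by simpa using h)
  exact ⟨by simp [map_fst_runFrom], hf.mem, fun s _ => hf.load_le⟩

theorem load_eq_of_length {S : Finset ℝ} {c : ℝ → ℕ} {M : Matching} (hM : ∀ e ∈ M, e.2 ∈ S)
    (hc : ∀ s ∈ S, load M s ≤ c s) (hn : M.length = ∑ s ∈ S, c s) : ∀ s ∈ S, load M s = c s := by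
  rw [← sum_load hM] at hn
  exact (Finset.sum_eq_sum_iff_of_le hc).mp hn

/-- When all capacities are used up, every server is used exactly `c s` times, in whichever
matching. -/
theorem perm_of_length {S : Finset ℝ} {c : ℝ → ℕ} {M E : Matching} (hM : ∀ e ∈ M, e.2 ∈ S)
    (hc : ∀ s ∈ S, load M s ≤ c s) (hn : M.length = ∑ s ∈ S, c s) (hE : ∀ e ∈ E, e.2 ∈ S)
    (hcE : ∀ s ∈ S, load E s ≤ c s) (hnE : E.length = ∑ s ∈ S, c s) :
    (M.map Prod.snd).Perm (E.map Prod.snd) := by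
  rw [List.perm_iff_count]
  intro s
  by_cases hs : s ∈ S
  · exact (load_eq_of_length hM hc hn s hs).trans (load_eq_of_length hE hcE hnE s hs).symm
  · rw [List.count_eq_zero_of_not_mem, List.count_eq_zero_of_not_mem]
    · intro h
      obtain ⟨e, he, rfl⟩ := List.mem_map.mp h
      exact hs (hE e he)
    · intro h
      obtain ⟨e, he, rfl⟩ := List.mem_map.mp h
      exact hs (hM e he)

theorem exists_bound (E : Matching) : ∃ B : ℝ, ∀ e ∈ E, |e.1| ≤ B ∧ |e.2| ≤ B := by
  induction E with
  | nil => exact ⟨0, by simp⟩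
  | cons e E ih =>
    obtain ⟨B, hB⟩ := ih
    refine ⟨max B (max |e.1| |e.2|), fun e' he' => ?_⟩
    rcases List.mem_cons.mp he' with rfl | he'
    · simp
    · exact ⟨(hB e' he').1.trans (le_max_left _ _), (hB e' he').2.trans (le_max_left _ _)⟩

theorem followsPtcp_of_follows {g : SplitRule} {S : Finset ℝ} {c : ℝ → ℕ} {E : Matching}
    (hE : Follows (ptcp g S c) E) : FollowsPtcp g S c S E := by
  intro r a M hM
  obtain ⟨h1, h2⟩ := hE r a M hM
  refine ⟨h1, fun _ => ?_⟩
  rw [Finset.inter_eq_left.mpr (show free S c M ⊆ S from Finset.filter_subset _ _)]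
  exact h2

/-! ### PTCP is `2 α + 1`-competitive -/

/-- On sequences that use up all capacities, PTCP costs at most `2 α + 1` times as much as any
feasible matching. -/
theorem cost_ptcp_le_of_length_eq {g : SplitRule} {S : Finset ℝ} {c : ℝ → ℕ} {α : ℝ}
    (hα0 : 0 ≤ α)
    (hα : ∀ T ⊆ S, 2 ≤ T.card → ∀ p ∈ T, ∀ q ∈ T, q - p ≤ α * (g.right T - g.left T))
    {σ : List ℝ} (hσ : σ.length = ∑ s ∈ S, c s) {M : Matching} (hM : IsFeasible S c σ M) :
    (ptcp g S c).totalCost σ ≤ (2 * α + 1) * cost M := by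
  obtain ⟨hE1, hE2, hE3⟩ := isFeasible_runFrom (ptcp g S c) hσ.le
  obtain ⟨hM1, hM2, hM3⟩ := hM
  have hE := follows_runFrom (follows_nil (ptcp g S c)) (σ := σ) (by simpa using hσ.le)
  rw [OnlineAlgorithm.totalCost]
  generalize (ptcp g S c).runFrom [] σ = E at *
  have hlM : M.length = ∑ s ∈ S, c s := by
    rw [← hσ, ← List.length_reverse (as := σ), ← hM1, List.length_map]
  have hlE : E.length = ∑ s ∈ S, c s := by
    rw [← hσ, ← List.length_reverse (as := σ), ← hE1, List.length_map]
  have hperm := perm_of_length hM2 hM3 hlM hE2 hE3 hlE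
  have hdiff : ∀ y, rightCross E y - leftCross E y = rightCross M y - leftCross M y := by
    intro y
    rw [rightCross_sub_leftCross, rightCross_sub_leftCross, hE1, hM1,
      (hperm.map fun s => if s < y then (1 : ℝ) else 0).sum_eq]
  rcases S.eq_empty_or_nonempty with rfl | hne
  · have hE0 : E = [] := List.length_eq_zero_iff.mp (by simpa using hlE)
    have hM0 : M = [] := List.length_eq_zero_iff.mp (by simpa using hlM)
    simp [hE0, hM0, cost]
  obtain ⟨B₁, hB₁⟩ := exists_bound E
  obtain ⟨B₂, hB₂⟩ := exists_bound M
  have hp := S.isLeast_min' hne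
  have hq := S.isGreatest_max' hne
  generalize S.min' hne = p at hp
  generalize S.max' hne = q at hq
  -- The window `[-B, B]` contains all requests and servers, so integrals over it give full costs.
  set B := max (max B₁ B₂) (max |p| |q|) with hB
  have hB1 : B₁ ≤ B := (le_max_left _ _).trans (le_max_left _ _)
  have hB2 : B₂ ≤ B := (le_max_right _ _).trans (le_max_left _ _)
  have hBp : -B ≤ p := (abs_le.mp ((le_max_left |p| |q|).trans (le_max_right _ _))).1
  have hBq : q ≤ B := (abs_le.mp ((le_max_right |p| |q|).trans (le_max_right _ _))).2
  have hpq : p ≤ q := hp.2 hq.1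
  have hcE := integral_cross (E := E) (p := -B) (q := B) fun e he =>
    ⟨by linarith [abs_le.mp (hB₁ e he).1], by linarith [abs_le.mp (hB₁ e he).2],
      by linarith [abs_le.mp (hB₁ e he).1], by linarith [abs_le.mp (hB₁ e he).2]⟩
  have hcM := integral_cross (E := M) (p := -B) (q := B) fun e he =>
    ⟨by linarith [abs_le.mp (hB₂ e he).1], by linarith [abs_le.mp (hB₂ e he).2],
      by linarith [abs_le.mp (hB₂ e he).1], by linarith [abs_le.mp (hB₂ e he).2]⟩
  -- At the root no server lies outside the hull, so `Λ = 0`.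
  have hmid : ∫ y in p..q, excess α E y ≤ 0 * (q - p) :=
    (followsPtcp_of_follows hE).integral_excess_le hα0 hα S subset_rfl hp hq (fun s hs _ _ => hs)
      (cnt_eq_zero fun e he hP => not_le.mpr hP.2 (hq.2 (hE2 e he))).le
      (cnt_eq_zero fun e he hP => not_le.mpr hP.2 (hp.2 (hE2 e he))).le
  have hleft : ∫ y in (-B)..p, excess α E y ≤ 0 * (p - -B) :=
    integral_excess_le hBp fun y hy => excess_le_left hα0
      (cnt_eq_zero fun e he hP => by linarith [hp.2 (hE2 e he), hP.1, hy.2]).le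
  have hright : ∫ y in q..B, excess α E y ≤ 0 * (B - q) :=
    integral_excess_le hBq fun y hy => excess_le_right hα0
      (cnt_eq_zero fun e he hP => by linarith [hq.2 (hE2 e he), hP.2, hy.1]).le
  have htot : ∫ y in (-B)..B, excess α E y ≤ 0 := by
    have hi := intervalIntegrable_excess α E
    rw [← intervalIntegral.integral_add_adjacent_intervals (hi (-B) q) (hi q B),
      ← intervalIntegral.integral_add_adjacent_intervals (hi (-B) p) (hi p q)]
    linarith
  have hex : ∫ y in (-B)..B, excess α E y = 2⁻¹ * cost E -
      (α + 2⁻¹) * ∫ y in (-B)..B, |leftCross E y - rightCross E y| := by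
    simp only [excess_eq]
    rw [intervalIntegral.integral_sub, intervalIntegral.integral_const_mul,
      intervalIntegral.integral_const_mul, hcE]
    · exact ((intervalIntegrable_leftCross _ _ _).add
        (intervalIntegrable_rightCross _ _ _)).const_mul _
    · exact (intervalIntegrable_abs_cross _ _ _).const_mul _
  have hle : ∫ y in (-B)..B, |leftCross E y - rightCross E y| ≤ cost M := by
    rw [← hcM]
    refine intervalIntegral.integral_mono_on (by linarith) (intervalIntegrable_abs_cross _ _ _)
      ((intervalIntegrable_leftCross _ _ _).add (intervalIntegrable_rightCross _ _ _)) ?_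
    intro y _
    have h1 : 0 ≤ leftCross M y := cnt_nonneg _ _
    have h2 : 0 ≤ rightCross M y := cnt_nonneg _ _
    rw [abs_le]
    constructor <;> linarith [hdiff y]
  nlinarith

/-- On all sequences that the servers can serve, PTCP costs at most `2 α + 1` times as much as
any feasible matching. -/
theorem cost_ptcp_le {g : SplitRule} {S : Finset ℝ} {c : ℝ → ℕ} {α : ℝ} (hα0 : 0 ≤ α)
    (hα : ∀ T ⊆ S, 2 ≤ T.card → ∀ p ∈ T, ∀ q ∈ T, q - p ≤ α * (g.right T - g.left T))
    {σ : List ℝ} (hσ : σ.length ≤ ∑ s ∈ S, c s) {M : Matching} (hM : IsFeasible S c σ M) :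
    (ptcp g S c).totalCost σ ≤ (2 * α + 1) * cost M := by
  obtain ⟨d, hd⟩ := Nat.exists_eq_add_of_le hσ
  induction d generalizing σ M with
  | zero => exact cost_ptcp_le_of_length_eq hα0 hα hd.symm hM
  | succ d ih =>
    obtain ⟨hM1, hM2, hM3⟩ := hM
    have hl : M.length = σ.length := by
      rw [← List.length_reverse (as := σ), ← hM1, List.length_map]
    obtain ⟨s, hs⟩ := free_nonempty (c := c) hM2 (by omega)
    obtain ⟨hsS, hlt⟩ := Finset.mem_filter.mp hs
    -- A request at a server with room in the offline matching adds nothing to the offline cost and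
    -- cannot lower the cost of PTCP.
    have hM' : IsFeasible S c (σ ++ [s]) ((s, s) :: M) := by
      refine ⟨by simp [hM1], ?_, fun t ht => ?_⟩
      · intro e he
        rcases List.mem_cons.mp he with rfl | he
        · exact hsS
        · exact hM2 e he
      · rw [load_cons]
        split_ifs with h
        · subst h; omega
        · exact hM3 t ht
    have hle := ih (σ := σ ++ [s]) (by simp; omega) hM' (by simp; omega)
    rw [cost_cons] at hle
    simp only [sub_self, abs_zero, zero_add] at hle
    refine le_trans ?_ hle
    rw [OnlineAlgorithm.totalCost, OnlineAlgorithm.totalCost, runFrom_append]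
    exact cost_le_cost_runFrom _ _ _

theorem isCompetitive_ptcp {g : SplitRule} {S : Finset ℝ} {c : ℝ → ℕ} {α : ℝ} (hα0 : 0 ≤ α)
    (hα : ∀ T ⊆ S, 2 ≤ T.card → ∀ p ∈ T, ∀ q ∈ T, q - p ≤ α * (g.right T - g.left T)) :
    (ptcp g S c).IsCompetitive (2 * α + 1) := by
  intro σ hσ
  have hpos : 0 < 2 * α + 1 := by linarith
  rw [mul_comm, ← div_le_iff₀ hpos]
  -- The infimum needs some feasible matching; that of PTCP itself will do.
  refine le_csInf ⟨_, _, isFeasible_runFrom (ptcp g S c) hσ, rfl⟩ ?_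
  rintro x ⟨M, hM, rfl⟩
  rw [div_le_iff₀ hpos, mul_comm]
  exact cost_ptcp_le hα0 hα hσ hM

theorem opt_le {S : Finset ℝ} {c : ℝ → ℕ} {σ : List ℝ} {M : Matching} (h : IsFeasible S c σ M) :
    opt S c σ ≤ cost M := by
  refine csInf_le ⟨0, ?_⟩ ⟨M, h, rfl⟩
  rintro x ⟨M, -, rfl⟩
  refine List.sum_nonneg fun x hx => ?_
  obtain ⟨e, -, rfl⟩ := List.mem_map.mp hx
  exact abs_nonneg _

/-! ### The doubling layout -/

theorem serverPos_one : serverPos 1 = 0 := by simp [serverPos]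

theorem serverPos_of_ne_one {i : ℕ} (h : i ≠ 1) : serverPos i = 2 ^ (i - 1) := by
  simp [serverPos, h]

theorem mem_layout {k : ℕ} {s : ℝ} :
    s ∈ layout k ↔ (s = 0 ∧ 1 ≤ k) ∨ ∃ m, 1 ≤ m ∧ m < k ∧ s = 2 ^ m := by
  simp only [layout, Finset.mem_image, Finset.mem_Icc]
  constructor
  · rintro ⟨i, ⟨h1, h2⟩, rfl⟩
    by_cases hi : i = 1
    · subst hi; exact Or.inl ⟨serverPos_one, h2⟩
    · exact Or.inr ⟨i - 1, by omega, by omega, serverPos_of_ne_one hi⟩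
  · rintro (⟨rfl, h⟩ | ⟨m, h1, h2, rfl⟩)
    · exact ⟨1, ⟨le_rfl, h⟩, serverPos_one⟩
    · exact ⟨m + 1, ⟨by omega, by omega⟩, by rw [serverPos_of_ne_one (by omega)]; simp⟩

theorem layout_nonneg {k : ℕ} {s : ℝ} (h : s ∈ layout k) : 0 ≤ s := by
  rcases mem_layout.mp h with ⟨rfl, -⟩ | ⟨m, -, -, rfl⟩
  · exact le_rfl
  · positivity

theorem two_mul_le_of_lt {k : ℕ} {s t : ℝ} (hs : s ∈ layout k) (ht : t ∈ layout k) (h : s < t) :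
    2 * s ≤ t := by
  rcases mem_layout.mp hs with ⟨rfl, -⟩ | ⟨m, -, -, rfl⟩
  · linarith
  · rcases mem_layout.mp ht with ⟨rfl, -⟩ | ⟨n, -, -, rfl⟩
    · exact absurd h (not_lt.mpr (by positivity))
    · rw [← pow_succ']
      exact pow_le_pow_right₀ one_le_two ((pow_lt_pow_iff_right₀ one_lt_two).mp h)

/-- In the layout, the gap below the largest point is at least half the diameter. -/
theorem exists_isAdjacent_layout {k : ℕ} {T : Finset ℝ} (hT : T ⊆ layout k) (h : 2 ≤ T.card) :
    ∃ u v, IsAdjacent T u v ∧ ∀ p ∈ T, ∀ q ∈ T, q - p ≤ 2 * (v - u) := by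
  have hv := T.isGreatest_max' (nonempty_of_two_le h)
  generalize T.max' (nonempty_of_two_le h) = v at hv
  have hne : (T.filter (· < v)).Nonempty := by
    obtain ⟨s, hs, hsv⟩ := Finset.exists_mem_ne (by omega : 1 < T.card) v
    exact ⟨s, Finset.mem_filter.mpr ⟨hs, lt_of_le_of_ne (hv.2 hs) hsv⟩⟩
  have hu := (T.filter (· < v)).isGreatest_max' hne
  generalize (T.filter (· < v)).max' hne = u at hu
  obtain ⟨huT, huv⟩ := Finset.mem_filter.mp hu.1
  refine ⟨u, v, ⟨huT, hv.1, huv, fun t ht htuv => ?_⟩, fun p hp q hq => ?_⟩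
  · exact not_lt.mpr (hu.2 (Finset.mem_coe.mpr (Finset.mem_filter.mpr ⟨ht, htuv.2⟩))) htuv.1
  -- The second largest point `u` is at most `v / 2`, so the gap is at least `v / 2`, while all
  -- points lie in `[0, v]`.
  · have h1 := two_mul_le_of_lt (hT huT) (hT hv.1) huv
    have h2 := layout_nonneg (hT hp)
    have h3 : q ≤ v := hv.2 hq
    linarith

theorem le_maxGap {T : Finset ℝ} {u v : ℝ} (h : IsAdjacent T u v) : v - u ≤ maxGap T := by
  refine le_csSup ?_ ⟨u, v, h, rfl⟩
  refine (((T ×ˢ T).image fun x : ℝ × ℝ => x.2 - x.1).finite_toSet.subset ?_).bddAbove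
  rintro _ ⟨u, v, h, rfl⟩
  simp only [Finset.coe_image, Set.mem_image, Finset.mem_coe, Finset.mem_product]
  exact ⟨(u, v), ⟨h.1, h.2.1⟩, rfl⟩

theorem L_le_two {k : ℕ} {T : Finset ℝ} (hT : T ⊆ layout k) : L T ≤ 2 := by
  rw [L]
  split_ifs with h
  · obtain ⟨u, v, huv, hle⟩ := exists_isAdjacent_layout hT h
    have h1 := le_maxGap huv
    have h2 := hle _ (T.min'_mem (nonempty_of_two_le h)) _ (T.max'_mem (nonempty_of_two_le h))
    have h3 := huv.2.2.1
    rw [div_le_iff₀ (by linarith)]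
    linarith
  · norm_num

theorem alpha_layout_le (k : ℕ) : alpha (layout k) ≤ 2 :=
  Finset.sup'_le _ _ fun _ hT => L_le_two (Finset.mem_powerset.mp hT)

/-- The first three servers have two equal gaps, so their diameter is twice the largest gap. -/
theorem two_le_L : 2 ≤ L {0, 2, 4} := by
  have hcard : 2 ≤ ({0, 2, 4} : Finset ℝ).card := by
    rw [Finset.card_eq_three.mpr ⟨0, 2, 4, by norm_num, by norm_num, by norm_num, rfl⟩]
    norm_num
  rw [L, dif_pos hcard]
  have hadj : IsAdjacent {0, 2, 4} 0 2 := by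
    refine ⟨by simp, by simp, by norm_num, fun t ht => ?_⟩
    simp only [Finset.mem_insert, Finset.mem_singleton] at ht
    rcases ht with rfl | rfl | rfl <;> norm_num
  have hgap : maxGap {0, 2, 4} ≤ 2 := by
    refine csSup_le ⟨_, 0, 2, hadj, rfl⟩ ?_
    rintro _ ⟨u, v, ⟨hu, hv, huv, hno⟩, rfl⟩
    have h2 := hno 2 (by simp)
    simp only [Finset.mem_insert, Finset.mem_singleton] at hu hv
    rcases hu with rfl | rfl | rfl <;> rcases hv with rfl | rfl | rfl <;> norm_num at *
  have hpos := le_maxGap hadj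
  rw [le_div_iff₀ (by linarith)]
  have h1 := Finset.min'_le ({0, 2, 4} : Finset ℝ) 0 (by simp)
  have h2 := Finset.le_max' ({0, 2, 4} : Finset ℝ) 4 (by simp)
  linarith

theorem alpha_layout_eq {k : ℕ} (hk : 3 ≤ k) : alpha (layout k) = 2 := by
  refine le_antisymm (alpha_layout_le k) (two_le_L.trans (Finset.le_sup' L ?_))
  rw [Finset.mem_powerset]
  intro s hs
  simp only [Finset.mem_insert, Finset.mem_singleton] at hs
  rw [mem_layout]
  rcases hs with rfl | rfl | rfl
  · exact Or.inl ⟨rfl, by omega⟩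
  · exact Or.inr ⟨1, by omega, by omega, by norm_num⟩
  · exact Or.inr ⟨2, by omega, by omega, by norm_num⟩

/-- The chosen gap is largest, hence at least the top gap and at least half the diameter; `α = 2`
gives `2 * 2 + 1`. -/
theorem isCompetitive_ptcp_layout (g : SplitRule) (k : ℕ) (c : ℝ → ℕ) :
    (ptcp g (layout k) c).IsCompetitive 5 := by
  have := isCompetitive_ptcp (g := g) (S := layout k) (c := c) (α := 2) (by norm_num)
    fun T hT h p hp q hq => by
      obtain ⟨u, v, huv, hle⟩ := exists_isAdjacent_layout hT h
      linarith [hle p hp q hq, (g.isMaxGap T h).2 u v huv]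
  norm_num at this
  exact this

/-! ### The lower bound for greedy algorithms -/

/-- Requests at the positions of free servers are matched with these servers by a greedy
algorithm. -/
theorem runFrom_of_isGreedy {S : Finset ℝ} {c : ℝ → ℕ} {G : OnlineAlgorithm S c} (hG : G.IsGreedy)
    {τ : List ℝ} {M : Matching} (hτ : ∀ s ∈ τ, s ∈ S)
    (hc : ∀ s ∈ S, load M s + τ.count s ≤ c s) :
    G.runFrom M τ = (τ.map fun s => (s, s)).reverse ++ M := by
  induction τ generalizing M with
  | nil => rfl
  | cons s τ ih =>
    have hs := hτ s List.mem_cons_self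
    have hfree : s ∈ free S c M := by
      have := hc s hs
      rw [List.count_cons_self] at this
      exact Finset.mem_filter.mpr ⟨hs, by omega⟩
    have hch : G.choose M s = s := by
      have := hG M s s hfree
      rw [sub_self, abs_zero] at this
      linarith [abs_eq_zero.mp (le_antisymm this (abs_nonneg _))]
    rw [OnlineAlgorithm.runFrom, hch, ih (fun t ht => hτ t (List.mem_cons_of_mem _ ht))]
    · simp
    · intro t ht
      have := hc t ht
      rw [load_cons]
      rw [List.count_cons] at this
      simp only [beq_iff_eq] at this
      omega

/-- The `i`-th of the requests that lead a greedy algorithm astray. -/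
def lureRequest (ε : ℝ) (i : ℕ) : ℝ := 2 ^ (i - 1) + ε

/-- Invariant before request `j`: the servers strictly between 0 and `2 ^ j` are full, all others
have one unit left. Request `i` then pays at least `2 ^ (i - 1) - ε`, and the last one at least `2 ^
(k - 1)`; these powers of two sum to `2 ^ k - 2 ^ (j - 1)`. -/
theorem cost_runFrom_lure {k : ℕ} {c : ℝ → ℕ} {G : OnlineAlgorithm (layout k) c}
    (hG : G.IsGreedy) {ε : ℝ} (hε : 0 < ε) (hε1 : ε < 1) (n j : ℕ) (hj : 1 ≤ j) (hjk : j + n = k)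
    {M : Matching} (hM : ∀ s ∈ layout k,
      if 0 < s ∧ s < 2 ^ j then load M s = c s else load M s + 1 = c s) :
    cost M + (2 ^ k - 2 ^ (j - 1)) - n * ε ≤
      cost (G.runFrom M ((List.range' j (n + 1)).map (lureRequest ε))) := by
  have hj2 : (2 : ℝ) ^ j = 2 * 2 ^ (j - 1) := by rw [← pow_succ', Nat.sub_add_cancel hj]
  have hpow : (1 : ℝ) ≤ 2 ^ (j - 1) := one_le_pow₀ one_le_two
  have hfree : ∀ s ∈ free (layout k) c M, s = 0 ∨ (2 : ℝ) ^ j ≤ s := by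
    intro s hs
    obtain ⟨hs, hlt⟩ := Finset.mem_filter.mp hs
    by_contra! hcon
    have := hM s hs
    rw [if_pos ⟨lt_of_le_of_ne (layout_nonneg hs) hcon.1.symm, hcon.2⟩] at this
    omega
  have hfree' : ∀ s ∈ layout k, (s = 0 ∨ (2 : ℝ) ^ j ≤ s) → s ∈ free (layout k) c M := by
    intro s hs h0
    refine Finset.mem_filter.mpr ⟨hs, ?_⟩
    have := hM s hs
    rw [if_neg (by rintro ⟨h1, h2⟩; rcases h0 with h0 | h0 <;> linarith)] at this
    omega
  have h0 : (0 : ℝ) ∈ free (layout k) c M :=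
    hfree' 0 (mem_layout.mpr (Or.inl ⟨rfl, by omega⟩)) (Or.inl rfl)
  have hmem := G.choose_mem M (lureRequest ε j) ⟨0, h0⟩
  have hmemS := (Finset.mem_filter.mp hmem).1
  have hnear := hG M (lureRequest ε j)
  rw [List.range'_succ, List.map_cons, OnlineAlgorithm.runFrom]
  cases n with
  -- At the last request `j = k`, and 0 is the only free server.
  | zero =>
    have hch : G.choose M (lureRequest ε j) = 0 := by
      refine (hfree _ hmem).resolve_right fun h => ?_
      rcases mem_layout.mp hmemS with ⟨h1, -⟩ | ⟨m, -, hm, h1⟩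
      · rw [h1] at h; linarith
      · rw [h1] at h
        have := (pow_le_pow_iff_right₀ (one_lt_two (α := ℝ))).mp h
        omega
    obtain rfl : j = k := by omega
    rw [hch]
    simp only [List.range'_zero, List.map_nil, OnlineAlgorithm.runFrom, cost_cons, lureRequest,
      sub_zero, Nat.cast_zero, zero_mul]
    rw [abs_of_pos (by linarith)]
    linarith
  | succ n =>
    have hlay : (2 : ℝ) ^ j ∈ layout k := mem_layout.mpr (Or.inr ⟨j, hj, by omega, rfl⟩)
    -- The server `2 ^ j` is at distance `2 ^ (j - 1) - ε`, the server 0 at distance `2 ^ (j - 1) +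
    -- ε`; any other free server is at least `2 ^ (j + 1)` and thus farther.
    have hch : G.choose M (lureRequest ε j) = 2 ^ j := by
      have hd := hnear _ (hfree' _ hlay (Or.inr le_rfl))
      rw [lureRequest, abs_of_neg (by linarith : (2 : ℝ) ^ (j - 1) + ε - 2 ^ j < 0)] at hd
      have hd' := abs_le.mp hd
      rcases hfree _ hmem with h | h
      · rw [lureRequest] at h
        rw [h] at hd'
        linarith
      · refine le_antisymm ?_ h
        by_contra! hlt
        have := two_mul_le_of_lt hlay hmemS hlt
        rw [lureRequest] at this
        linarith
    rw [hch]
    have hrec := cost_runFrom_lure hG hε hε1 n (j + 1) (by omega) (by omega)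
      (M := (lureRequest ε j, 2 ^ j) :: M) (by
        intro s hs
        have hs' := hM s hs
        rw [load_cons]
        by_cases hsj : (2 : ℝ) ^ j = s
        · rw [if_neg (fun h => by linarith [h.2])] at hs'
          rw [if_pos ⟨by linarith, by rw [← hsj]; exact pow_lt_pow_right₀ one_lt_two (by omega)⟩,
            if_pos hsj]
          exact hs'
        · rw [if_neg hsj, add_zero]
          have hiff : (0 < s ∧ s < 2 ^ (j + 1)) ↔ (0 < s ∧ s < 2 ^ j) := by
            refine ⟨fun h => ⟨h.1, ?_⟩, fun h => ⟨h.1, by rw [pow_succ]; linarith [h.2]⟩⟩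
            by_contra! hle
            have := two_mul_le_of_lt hlay hs (lt_of_le_of_ne hle hsj)
            rw [pow_succ] at h
            linarith [h.2]
          rw [if_congr hiff rfl rfl]
          exact hs')
    rw [cost_cons, Nat.add_sub_cancel] at hrec
    simp only [lureRequest] at hrec
    rw [abs_of_neg (by linarith)] at hrec
    refine le_trans ?_ hrec
    push_cast
    linarith

theorem serverPos_mem_layout {k i : ℕ} (h1 : 1 ≤ i) (h2 : i ≤ k) : serverPos i ∈ layout k :=
  Finset.mem_image_of_mem _ (Finset.mem_Icc.mpr ⟨h1, h2⟩)

theorem serverPos_injOn : Set.InjOn serverPos {i | 1 ≤ i} := by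
  intro i hi j hj h
  simp only [Set.mem_ofPred_eq] at hi hj
  by_cases hi1 : i = 1 <;> by_cases hj1 : j = 1
  · omega
  · rw [hi1, serverPos_one, serverPos_of_ne_one hj1] at h
    exact absurd h (by positivity)
  · rw [hj1, serverPos_one, serverPos_of_ne_one hi1] at h
    exact absurd h (by positivity)
  · rw [serverPos_of_ne_one hi1, serverPos_of_ne_one hj1] at h
    have := pow_right_injective₀ (zero_lt_two (α := ℝ)) (by norm_num) h
    omega

theorem count_serverPos {k : ℕ} {s : ℝ} (hs : s ∈ layout k) :
    ((List.range' 1 k).map serverPos).count s = 1 := by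
  refine List.count_eq_one_of_mem ?_ ?_
  · refine List.Nodup.map_on (fun i hi j hj h => serverPos_injOn ?_ ?_ h) List.nodup_range'
    · exact (List.mem_range'_1.mp hi).1
    · exact (List.mem_range'_1.mp hj).1
  · obtain ⟨i, hi, rfl⟩ := Finset.mem_image.mp hs
    rw [Finset.mem_Icc] at hi
    exact List.mem_map_of_mem (List.mem_range'_1.mpr ⟨hi.1, by omega⟩)

theorem exists_list_count (S : Finset ℝ) (n : ℝ → ℕ) :
    ∃ τ : List ℝ, (∀ s ∈ τ, s ∈ S) ∧ ∀ s ∈ S, τ.count s = n s := by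
  refine ⟨(∑ s ∈ S, Multiset.replicate (n s) s).toList, fun s hs => ?_, fun s hs => ?_⟩
  · rw [Multiset.mem_toList, Multiset.mem_sum] at hs
    obtain ⟨t, ht, hst⟩ := hs
    rwa [Multiset.eq_of_mem_replicate hst]
  · rw [← Multiset.coe_count, Multiset.coe_toList, Multiset.count_sum']
    simp [Multiset.count_replicate, hs]

theorem cost_append (M M' : Matching) : cost (M ++ M') = cost M + cost M' := by
  simp [cost]

theorem cost_reverse (M : Matching) : cost M.reverse = cost M := by
  simp [cost, List.sum_reverse]

theorem cost_diagonal (τ : List ℝ) : cost (τ.map fun s => (s, s)) = 0 := by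
  simp [cost, Function.comp_def]

theorem load_append (M M' : Matching) (s : ℝ) : load (M ++ M') s = load M s + load M' s := by
  simp [load]

theorem load_diagonal (τ : List ℝ) (s : ℝ) :
    load (τ.map fun s => (s, s)).reverse s = τ.count s := by
  simp [load, Function.comp_def]

/-- Matched in order, the first request pays `1 + ε` to reach 0, and each later one has its own
server at distance `ε`. -/
theorem cost_lure_le {ε : ℝ} (hε : 0 < ε) (n : ℕ) :
    cost ((List.range' 1 n).map fun i => (lureRequest ε i, serverPos i)) ≤ 1 + n * ε := by
  have h : ∀ n, cost ((List.range' 2 n).map fun i => (lureRequest ε i, serverPos i)) ≤ n * ε := by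
    intro n
    induction n with
    | zero => simp [cost]
    | succ n ih =>
      rw [List.range'_1_concat, List.map_append, cost_append, List.map_singleton, cost_cons,
        serverPos_of_ne_one (by omega), lureRequest, add_sub_cancel_left, abs_of_pos hε]
      simp only [cost, List.map_nil, List.sum_nil] at ih ⊢
      push_cast
      linarith
  cases n with
  | zero => simp [cost]
  | succ n =>
    rw [List.range'_succ, List.map_cons, cost_cons, serverPos_one, lureRequest]
    have := h n
    simp only [Nat.sub_self, pow_zero, sub_zero]
    rw [abs_of_pos (by linarith)]
    push_cast
    linarith

theorem le_of_isCompetitive_of_isGreedy {k : ℕ} (hk : 1 ≤ k) {c : ℝ → ℕ}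
    (hc : ∀ s ∈ layout k, 1 ≤ c s) {G : OnlineAlgorithm (layout k) c} (hG : G.IsGreedy) {ρ : ℝ}
    (hρ1 : 1 ≤ ρ) (hρ : G.IsCompetitive ρ) {ε : ℝ} (hε : 0 < ε) (hε1 : ε < 1) :
    2 ^ k - 1 - k * ε ≤ ρ * (1 + k * ε) := by
  -- These requests, made at server positions and free of cost for both sides, leave exactly one
  -- unit at each server, which reduces the problem to unit capacities.
  obtain ⟨τ, hτS, hτ⟩ := exists_list_count (layout k) fun s => c s - 1
  have hrun := runFrom_of_isGreedy hG (M := []) hτS fun s hs => by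
    have := hc s hs
    rw [hτ s hs]
    simp only [load, List.map_nil, List.count_nil]
    omega
  rw [List.append_nil] at hrun
  have hfeas : IsFeasible (layout k) c (τ ++ (List.range' 1 k).map (lureRequest ε))
      (((List.range' 1 k).map fun i => (lureRequest ε i, serverPos i)).reverse ++
        (τ.map fun s => (s, s)).reverse) := by
    refine ⟨by simp [Function.comp_def], fun e he => ?_, fun s hs => ?_⟩
    · simp only [List.mem_append, List.mem_reverse, List.mem_map] at he
      rcases he with ⟨i, hi, rfl⟩ | ⟨s, hs, rfl⟩
      · rw [List.mem_range'_1] at hi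
        exact serverPos_mem_layout hi.1 (by omega)
      · exact hτS s hs
    · rw [load_append, load_diagonal, hτ s hs]
      have h1 := count_serverPos hs
      have h2 := hc s hs
      simp only [load, List.map_reverse, List.count_reverse, List.map_map]
      change ((List.range' 1 k).map serverPos).count s + _ ≤ _
      omega
  have hopt := opt_le hfeas
  rw [cost_append, cost_reverse, cost_reverse, cost_diagonal, add_zero] at hopt
  have hlen : (τ ++ (List.range' 1 k).map (lureRequest ε)).length ≤ ∑ s ∈ layout k, c s := by
    rw [← List.length_reverse, ← hfeas.1, List.length_map, ← sum_load hfeas.2.1]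
    exact Finset.sum_le_sum hfeas.2.2
  have hcomp := hρ _ hlen
  rw [OnlineAlgorithm.totalCost, runFrom_append, hrun] at hcomp
  have hlow := cost_runFrom_lure hG hε hε1 (k - 1) 1 le_rfl (by omega)
    (M := (τ.map fun s => (s, s)).reverse) fun s hs => by
      have h2 := hc s hs
      rw [load_diagonal, hτ s hs, if_neg]
      · omega
      · rintro ⟨h0, hlt⟩
        rcases mem_layout.mp hs with ⟨rfl, -⟩ | ⟨m, hm, -, rfl⟩
        · exact lt_irrefl _ h0
        · exact absurd ((pow_lt_pow_iff_right₀ (one_lt_two (α := ℝ))).mp hlt) (by omega)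
  rw [Nat.sub_add_cancel hk, cost_reverse, cost_diagonal, Nat.cast_sub hk] at hlow
  norm_num at hlow
  have hmul := mul_le_mul_of_nonneg_left (hopt.trans (cost_lure_le hε k)) (zero_le_one.trans hρ1)
  linarith

theorem competitiveRatio_of_isGreedy {k : ℕ} (hk : 1 ≤ k) {c : ℝ → ℕ}
    (hc : ∀ s ∈ layout k, 1 ≤ c s) {G : OnlineAlgorithm (layout k) c} (hG : G.IsGreedy) :
    (((2 : ℝ) ^ k - 1 : ℝ) : EReal) ≤ G.competitiveRatio := by
  refine le_sInf ?_
  rintro _ ⟨ρ, ⟨hρ1, hρ⟩, rfl⟩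
  refine EReal.coe_le_coe_iff.mpr (le_of_forall_pos_le_add fun δ hδ => ?_)
  have hden : 0 < k * (1 + ρ) + δ := by positivity
  -- The bound rearranges to `2 ^ k - 1 ≤ ρ + k * (1 + ρ) * ε`. This `ε` is below 1 and makes the
  -- error term at most `δ`.
  have hε := le_of_isCompetitive_of_isGreedy hk hc hG hρ1 hρ (ε := δ / (k * (1 + ρ) + δ))
    (by positivity) (by
      rw [div_lt_one hden]
      have : 0 < (k : ℝ) * (1 + ρ) := by positivity
      linarith)
  have hδ' : k * (1 + ρ) * (δ / (k * (1 + ρ) + δ)) ≤ δ := by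
    rw [mul_div_assoc', div_le_iff₀ hden]
    nlinarith
  linarith

end OFAL

end

theorem mainTheorem3 (k : ℕ) (hk : 1 ≤ k) :
    OFAL.alpha (OFAL.layout k) ≤ 2 ∧
    (3 ≤ k → OFAL.alpha (OFAL.layout k) = 2) ∧
    ∀ c : ℝ → ℕ, (∀ s ∈ OFAL.layout k, 1 ≤ c s) →
      (∀ g : OFAL.SplitRule, (OFAL.ptcp g (OFAL.layout k) c).IsCompetitive 5) ∧
      ∀ G : OFAL.OnlineAlgorithm (OFAL.layout k) c, G.IsGreedy →
        (((2 : ℝ) ^ k - 1 : ℝ) : EReal) ≤ G.competitiveRatio :=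
  ⟨OFAL.alpha_layout_le k, OFAL.alpha_layout_eq, fun c hc =>
    ⟨fun g => OFAL.isCompetitive_ptcp_layout g k c, fun _ hG =>
      OFAL.competitiveRatio_of_isGreedy hk hc hG⟩⟩
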